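/- Let $N$ parties be given, the $p$-th with state space $\mathbb{C}^{d_p}$, and let $\mathcal{S}=\{|\psi_1\rangle,\dots,|\psi_n\rangle\}\subset\bigotimes_{p=1}^N\mathbb{C}^{d_p}$ be a set of $n$ orthonormal states known to the parties. Let $1\le m<n$. For distinct indices $a_1,\dots,a_m$, unknown to the parties, they share $|\psi_{a_1}\rangle\otimes\cdots\otimes|\psi_{a_m}\rangle$, each party holding its $m$ subsystems. An LOCC protocol consists of finitely many rounds, in each of which one party performs a quantum measurement (possibly with ancillas) on its own system and announces the outcome to all the others; later measurements and the final output may depend on all earlier outcomes. $\mathcal{S}$ is called $(n,m)$-identifiable if a single LOCC protocol determines the set $\{a_1,\dots,a_m\}$ with probability $1$ for every choice of $(a_1,\dots,a_m)$, and $(n,m)$-markable if a single LOCC protocol determines the tuple $(a_1,\dots,a_m)$ with probability $1$ for every such choice. **Theorem.** An $(n,m)$-identifiable set of orthonormal states need not be $(n,m)$-markable. More precisely, let $$|B_1\rangle=\tfrac{1}{\sqrt2}(|00\rangle+|11\rangle),\quad |B_2\rangle=\tfrac{1}{\sqrt2}(|00\rangle-|11\rangle),\quad |B_3\rangle=\tfrac{1}{\sqrt2}(|01\rangle+|10\rangle),\quad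 |B_4\rangle=\tfrac{1}{\sqrt2}(|01\rangle-|10\rangle)$$ in $\mathbb{C}^2\otimes\mathbb{C}^2$, shared by two parties. Let $\mathcal{S}$ be any set of three of these four states, for example $\{|B_1\rangle,|B_2\rangle,|B_3\rangle\}$. Then $\mathcal{S}$ is orthonormal and $(3,2)$-identifiable, by the protocol in which each party measures its own two qubits in the basis $|B_1\rangle,\dots,|B_4\rangle$ and the subset is then read off from the two outcomes; but $\mathcal{S}$ is not $(3,2)$-markable. -/

import Mathlib

noncomputable section

namespace LocalSubset

open scoped Matrix

/-- Pure states (as vectors) of a finite family of systems; party `p` holds a system with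
orthonormal basis `X p`, so this is `⨂ₚ ℂ^(X p)` in its product basis. -/
abbrev Vec {P : Type} (X : P → Type) : Type := EuclideanSpace ℂ (∀ p, X p)

section Protocols

variable {P : Type} [Fintype P] [DecidableEq P]

/-- The operator `M` on party `p`, tensored with the identity on all other parties. -/
def applyAt {Z : P → Type} [∀ p, Fintype (Z p)] (p : P) (M : Matrix (Z p) (Z p) ℂ)
    (ψ : Vec Z) : Vec Z :=
  WithLp.toLp 2 fun z => ∑ x : Z p, M (z p) x * ψ (Function.update z p x)

/-- The operator `⨂ₚ V p`. -/
def applyLocal {X Z : P → Type} [∀ p, Fintype (X p)]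
    (V : ∀ p, Matrix (Z p) (X p) ℂ) (ψ : Vec X) : Vec Z :=
  WithLp.toLp 2 fun z => ∑ x : ∀ p, X p, (∏ p, V p (z p) (x p)) * ψ x

/-- The rounds of a protocol. Either the protocol stops with output `l`, or one party `p` performs
a measurement with Kraus operators `M o` on its own system and announces the outcome `o` to
everybody; all that follows may depend on it. -/
inductive Rounds (Z : P → Type) [∀ p, Fintype (Z p)] [∀ p, DecidableEq (Z p)] (L : Type) : Type
  | output (l : L) : Rounds Z L
  | measure (p : P) (r : ℕ) (M : Fin r → Matrix (Z p) (Z p) ℂ)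
      (complete : ∑ o, (M o)ᴴ * M o = 1) (next : Fin r → Rounds Z L) : Rounds Z L

/-- The probability that the output is `l` when the rounds are run on `ψ`. The vector passed on
after each measurement is not normalized: its squared norm is the probability of the transcript. -/
def Rounds.prob {Z : P → Type} [∀ p, Fintype (Z p)] [∀ p, DecidableEq (Z p)] {L : Type}
    [DecidableEq L] (l : L) : Rounds Z L → Vec Z → ℝ
  | .output l', ψ => if l' = l then ‖ψ‖ ^ 2 else 0
  | .measure p _ M _ next, ψ => ∑ o, (next o).prob l (applyAt p (M o) ψ)

/-- An LOCC protocol (local operations and classical communication) with outputs in `L`, for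
parties that hold the systems `X p`: every party embeds its system isometrically into a
finite-dimensional one of any size (this adjoins ancillas in a fixed state, so that general Kraus
operators become square ones), and then they run finitely many rounds of local measurements and
broadcasts. -/
structure LOCC (X : P → Type) [∀ p, Fintype (X p)] [∀ p, DecidableEq (X p)] (L : Type) where
  /-- The local systems, including ancillas. -/
  space : P → Type
  [fintypeSpace : ∀ p, Fintype (space p)]
  [decEqSpace : ∀ p, DecidableEq (space p)]
  /-- The local embeddings. -/
  embed : ∀ p, Matrix (space p) (X p) ℂ
  isometry : ∀ p, (embed p)ᴴ * embed p = 1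
  rounds : Rounds space L

/-- The probability that the protocol outputs `l` on the shared state `ψ`. -/
def LOCC.prob {X : P → Type} [∀ p, Fintype (X p)] [∀ p, DecidableEq (X p)] {L : Type}
    [DecidableEq L] (π : LOCC X L) (ψ : Vec X) (l : L) : ℝ :=
  letI := π.fintypeSpace
  letI := π.decEqSpace
  π.rounds.prob l (applyLocal π.embed ψ)

/-- Party `p`'s system when `m` states are distributed: `m` copies of `X p`. -/
abbrev Copies (X : P → Type) (m : ℕ) : P → Type := fun p => Fin m → X p

variable {X : P → Type} {n m : ℕ}

/-- The state `ψ (a 0) ⊗ ⋯ ⊗ ψ (a (m - 1))`, regrouped so that each party holds its share of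
every factor. -/
def shared (ψ : Fin n → Vec X) (a : Fin m ↪ Fin n) : Vec (Copies X m) :=
  WithLp.toLp 2 fun x => ∏ k, ψ (a k) fun p => x p k

variable [∀ p, Fintype (X p)] [∀ p, DecidableEq (X p)]

/-- The protocol determines with certainty which `m` distinct members of the family are shared,
whatever they are and in whatever order they come. -/
def LOCC.Identifies (π : LOCC (Copies X m) (Finset (Fin n))) (ψ : Fin n → Vec X) : Prop :=
  ∀ a : Fin m ↪ Fin n, π.prob (shared ψ a) (Finset.univ.map a) = 1

/-- The protocol determines with certainty which `m` distinct members of the family are shared,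
and in which order. -/
def LOCC.Marks (π : LOCC (Copies X m) (Fin m ↪ Fin n)) (ψ : Fin n → Vec X) : Prop :=
  ∀ a : Fin m ↪ Fin n, π.prob (shared ψ a) a = 1

/-- `(n, m)`-identifiability of a family of `n` states. -/
def Identifiable (ψ : Fin n → Vec X) (m : ℕ) : Prop :=
  ∃ π : LOCC (Copies X m) (Finset (Fin n)), π.Identifies ψ

/-- `(n, m)`-markability of a family of `n` states. -/
def Markable (ψ : Fin n → Vec X) (m : ℕ) : Prop :=
  ∃ π : LOCC (Copies X m) (Fin m ↪ Fin n), π.Marks ψ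

end Protocols

section Bell

/-- Two parties with one qubit each. -/
abbrev Qubits : Fin 2 → Type := fun _ => Fin 2

/-- The product basis vector `|s t⟩` of two qubits. -/
def ket (s t : Fin 2) : EuclideanSpace ℂ (Fin 2 → Fin 2) := EuclideanSpace.single ![s, t] 1

/-- The four Bell states of two qubits. -/
def bell : Fin 4 → EuclideanSpace ℂ (Fin 2 → Fin 2) :=
  ![(1 / (Real.sqrt 2 : ℂ)) • (ket 0 0 + ket 1 1),
    (1 / (Real.sqrt 2 : ℂ)) • (ket 0 0 - ket 1 1),
    (1 / (Real.sqrt 2 : ℂ)) • (ket 0 1 + ket 1 0),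
    (1 / (Real.sqrt 2 : ℂ)) • (ket 0 1 - ket 1 0)]

/-- Three of the four Bell states, as states shared between the two parties. -/
def threeBell (e : Fin 3 ↪ Fin 4) : Fin 3 → Vec Qubits := fun i => bell (e i)

/-- The projector `|Bᵢ⟩⟨Bᵢ|`. -/
def bellProj (i : Fin 4) : Matrix (Fin 2 → Fin 2) (Fin 2 → Fin 2) ℂ :=
  Matrix.of fun x y => bell i x * star (bell i y)

theorem bellProj_complete : ∑ i, (bellProj i)ᴴ * bellProj i = 1 := by
  have h : ((Real.sqrt 2 : ℝ) : ℂ) * (Real.sqrt 2 : ℝ) = 2 := by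
    rw [← Complex.ofReal_mul, Real.mul_self_sqrt (by norm_num)]; norm_num
  have h0 : ((Real.sqrt 2 : ℝ) : ℂ) ≠ 0 := by
    intro h0; simp [h0] at h
  have hi : ((Real.sqrt 2 : ℝ) : ℂ)⁻¹ * ((Real.sqrt 2 : ℝ) : ℂ)⁻¹ = 1 / 2 := by
    rw [← mul_inv, h]; norm_num
  have hs : ∀ f : (Fin 2 → Fin 2) → ℂ,
      ∑ z, f z = f ![0, 0] + f ![0, 1] + f ![1, 0] + f ![1, 1] := by
    intro f
    rw [← (finTwoArrowEquiv (Fin 2)).symm.sum_comp, Fintype.sum_prod_type]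
    simp [Fin.sum_univ_two, add_assoc]
  have hx : ∀ x : Fin 2 → Fin 2, x = ![0, 0] ∨ x = ![0, 1] ∨ x = ![1, 0] ∨ x = ![1, 1] := by
    decide
  ext x y
  rw [Matrix.sum_apply]
  simp only [Matrix.mul_apply, Matrix.conjTranspose_apply, hs, Fin.sum_univ_four]
  rcases hx x with rfl | rfl | rfl | rfl <;> rcases hx y with rfl | rfl | rfl | rfl <;>
    simp [bellProj, bell, ket] <;> grind

/-- Two states of a two-qubit system are shared, so each party holds two qubits. Each party
measures its own two qubits in the Bell basis, and the output `out i j` is read off from the two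
outcomes `i` (party `0`) and `j` (party `1`). -/
def bellProtocol {L : Type} (out : Fin 4 → Fin 4 → L) : LOCC (Copies Qubits 2) L where
  space := Copies Qubits 2
  embed := fun _ => 1
  isometry := fun _ => by simp
  rounds := .measure 0 4 bellProj bellProj_complete fun i =>
    .measure 1 4 bellProj bellProj_complete fun j => .output (out i j)

end Bell

end LocalSubset

end

/-
Every transcript of an LOCC protocol acts on the shared state as a product operator `⨂ₚ V p`. If
the reduced state of party `p` is `κ • 1`, then, written across the cut between `p` and the others,
the state is a matrix `A` with `A * Aᴴ = κ • 1`, so that in the Frobenius norm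
`‖V * A * Wᵀ‖ ^ 2 ≤ ‖V * A‖ ^ 2 * ‖W‖ ^ 2 = κ * ‖V‖ ^ 2 * ‖W‖ ^ 2`: the weight of the transcript is
at most `κ` times the sum of its weights on the product basis. Summing over transcripts, at most
`κ * D` such states can be told apart by LOCC in total dimension `D`. For `m` copies `κ` and `D`
become `κ ^ m` and `D ^ m`; three Bell states have `κ = 1 / 2` and `D = 4`, and the `6` ordered
pairs exceed `(κ * D) ^ 2 = 4`.

Identification is entanglement swapping: on `B_a ⊗ B_b` the two Bell measurements can only give
outcomes `i`, `j` with `i * j = a * b` in the Klein four-group, and for three distinct labels the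
three products of pairs are distinct.
-/

noncomputable section

namespace LocalSubset

open scoped Matrix Matrix.Norms.Frobenius

section Frobenius

variable {𝕜 : Type*} [RCLike 𝕜] {l m n : Type*} [Fintype l] [Fintype m] [Fintype n]

theorem frobenius_norm_sq (A : Matrix m n 𝕜) : ‖A‖ ^ 2 = ∑ i, ∑ j, ‖A i j‖ ^ 2 := by
  rw [Matrix.frobenius_norm_def, ← Real.sqrt_eq_rpow, Real.sq_sqrt (by positivity)]
  simp only [Real.rpow_ofNat]

theorem trace_conjTranspose_mul_self (A : Matrix m n 𝕜) : (Aᴴ * A).trace = (‖A‖ ^ 2 : ℝ) := by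
  rw [frobenius_norm_sq, Finset.sum_comm]
  simp [Matrix.trace, Matrix.mul_apply, RCLike.conj_mul]

theorem sum_frobenius_norm_sq_mul [DecidableEq m] {ι : Type*} [Fintype ι] {M : ι → Matrix l m 𝕜}
    (hM : ∑ o, (M o)ᴴ * M o = 1) (A : Matrix m n 𝕜) : ∑ o, ‖M o * A‖ ^ 2 = ‖A‖ ^ 2 := by
  have htrace : ∑ o, ((M o * A)ᴴ * (M o * A)).trace = (Aᴴ * A).trace := by
    simp only [Matrix.conjTranspose_mul, Matrix.mul_assoc]
    simp only [← Matrix.mul_assoc (M _)ᴴ]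
    rw [← Matrix.trace_sum, ← Matrix.mul_sum, ← Matrix.sum_mul, hM, Matrix.one_mul]
  simp only [trace_conjTranspose_mul_self] at htrace
  exact_mod_cast htrace

theorem frobenius_norm_sq_of_conjTranspose_mul_self [DecidableEq n] {V : Matrix m n 𝕜}
    (hV : Vᴴ * V = 1) : ‖V‖ ^ 2 = Fintype.card n := by
  have htrace := trace_conjTranspose_mul_self V
  rw [hV, Matrix.trace_one] at htrace
  exact_mod_cast htrace.symm

theorem frobenius_norm_sq_mul_of_mul_conjTranspose_self [DecidableEq m] {A : Matrix m n 𝕜} {κ : ℝ}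
    (hA : A * Aᴴ = κ • 1) (V : Matrix l m 𝕜) : ‖V * A‖ ^ 2 = κ * ‖V‖ ^ 2 := by
  have htrace : ((V * A)ᴴ * (V * A)).trace = κ • (Vᴴ * V).trace := by
    rw [Matrix.trace_mul_comm, Matrix.conjTranspose_mul, Matrix.mul_assoc, ← Matrix.mul_assoc A,
      hA, Matrix.smul_mul, Matrix.one_mul, Matrix.mul_smul, Matrix.trace_smul,
      Matrix.trace_mul_comm]
  rw [trace_conjTranspose_mul_self, trace_conjTranspose_mul_self, RCLike.real_smul_eq_coe_mul]
    at htrace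
  exact_mod_cast htrace

end Frobenius

section TensorMatrix

variable {P : Type*} [Fintype P] {X Z : P → Type*}

/-- The tensor product `⨂ₚ A p` of a finite family of matrices, in the product bases. -/
def tensorMatrix {R : Type*} [CommSemiring R] (A : ∀ p, Matrix (Z p) (X p) R) :
    Matrix (∀ p, Z p) (∀ p, X p) R :=
  Matrix.of fun z x => ∏ p, A p (z p) (x p)

theorem tensorMatrix_one {R : Type*} [CommSemiring R] [∀ p, DecidableEq (X p)] :
    tensorMatrix (fun p => (1 : Matrix (X p) (X p) R)) = 1 := by
  ext z x
  simp [tensorMatrix, Matrix.one_apply, Fintype.prod_ite_zero, funext_iff]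

theorem tensorMatrix_smul {R S : Type*} [CommSemiring R] [CommSemiring S] [Algebra S R] (c : P → S)
    (A : ∀ p, Matrix (Z p) (X p) R) :
    tensorMatrix (fun p => c p • A p) = (∏ p, c p) • tensorMatrix A := by
  ext z x
  simp [tensorMatrix, Algebra.smul_def, Finset.prod_mul_distrib]

theorem frobenius_norm_sq_tensorMatrix {𝕜 : Type*} [RCLike 𝕜] [DecidableEq P] [∀ p, Fintype (X p)]
    [∀ p, Fintype (Z p)] (A : ∀ p, Matrix (Z p) (X p) 𝕜) :
    ‖tensorMatrix A‖ ^ 2 = ∏ p, ‖A p‖ ^ 2 := by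
  simp only [frobenius_norm_sq, tensorMatrix, Matrix.of_apply, norm_prod, Finset.prod_pow,
    Fintype.prod_sum]

end TensorMatrix

section Cut

variable {P : Type} [DecidableEq P] {X Z : P → Type}

theorem piSplitAt_symm_self (p : P) (s : X p) (y : ∀ q : {q // q ≠ p}, X q) :
    (Equiv.piSplitAt p X).symm (s, y) p = s := by
  simp [Equiv.piSplitAt]

theorem piSplitAt_symm_coe (p : P) (s : X p) (y : ∀ q : {q // q ≠ p}, X q) (q : {q // q ≠ p}) :
    (Equiv.piSplitAt p X).symm (s, y) q = y q := by
  simp [Equiv.piSplitAt, q.2]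

theorem update_piSplitAt_symm (p : P) (s t : X p) (y : ∀ q : {q // q ≠ p}, X q) :
    Function.update ((Equiv.piSplitAt p X).symm (s, y)) p t =
      (Equiv.piSplitAt p X).symm (t, y) := by
  rw [Function.update_eq_iff]
  refine ⟨(piSplitAt_symm_self p t y).symm, fun q hq => ?_⟩
  rw [piSplitAt_symm_coe p s y ⟨q, hq⟩, piSplitAt_symm_coe p t y ⟨q, hq⟩]

/-- The coefficient matrix of `ψ` across the cut between party `p` and all other parties. Local
operators act on it by matrix multiplication from the two sides. -/
def cutMatrix (p : P) (ψ : Vec X) : Matrix (X p) (∀ q : {q // q ≠ p}, X q) ℂ :=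
  Matrix.of fun x y => ψ ((Equiv.piSplitAt p X).symm (x, y))

theorem cutMatrix_injective (p : P) : Function.Injective (cutMatrix (X := X) p) := by
  intro ψ φ h
  ext x
  obtain ⟨⟨s, y⟩, rfl⟩ := (Equiv.piSplitAt p X).symm.surjective x
  exact congrFun (congrFun h s) y

theorem cutMatrix_applyAt [∀ p, Fintype (X p)] (p : P) (M : Matrix (X p) (X p) ℂ) (ψ : Vec X) :
    cutMatrix p (applyAt p M ψ) = M * cutMatrix p ψ := by
  ext s y
  simp [cutMatrix, applyAt, Matrix.mul_apply, update_piSplitAt_symm]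

variable [Fintype P] [∀ p, Fintype (X p)]

theorem applyLocal_one [∀ p, DecidableEq (X p)] (ψ : Vec X) :
    applyLocal (fun p => (1 : Matrix (X p) (X p) ℂ)) ψ = ψ := by
  ext z
  exact congrFun (congrArg (· *ᵥ ψ.ofLp) tensorMatrix_one |>.trans (Matrix.one_mulVec _)) z

theorem sum_norm_sq_applyLocal_single [∀ p, DecidableEq (X p)] [∀ p, Fintype (Z p)]
    (V : ∀ p, Matrix (Z p) (X p) ℂ) :
    ∑ x, ‖applyLocal V (EuclideanSpace.single x 1)‖ ^ 2 = ∏ p, ‖V p‖ ^ 2 := by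
  rw [← frobenius_norm_sq_tensorMatrix, frobenius_norm_sq, Finset.sum_comm]
  simp [applyLocal, tensorMatrix, EuclideanSpace.norm_sq_eq]

theorem frobenius_norm_sq_cutMatrix (p : P) (ψ : Vec X) : ‖cutMatrix p ψ‖ ^ 2 = ‖ψ‖ ^ 2 := by
  rw [frobenius_norm_sq, EuclideanSpace.norm_sq_eq, ← (Equiv.piSplitAt p X).symm.sum_comp,
    Fintype.sum_prod_type]
  rfl

theorem cutMatrix_applyLocal (p : P) (V : ∀ p, Matrix (Z p) (X p) ℂ) (ψ : Vec X) :
    cutMatrix p (applyLocal V ψ) =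
      V p * cutMatrix p ψ * (tensorMatrix fun q : {q // q ≠ p} => V q)ᵀ := by
  ext s y
  simp only [cutMatrix, applyLocal, tensorMatrix, Matrix.mul_apply, Matrix.of_apply,
    Matrix.transpose_apply, ← (Equiv.piSplitAt p X).symm.sum_comp, Fintype.sum_prod_type_right,
    Finset.sum_mul, Fintype.prod_eq_mul_prod_subtype_ne _ p, piSplitAt_symm_self,
    piSplitAt_symm_coe, mul_right_comm]

theorem applyAt_applyLocal [∀ p, Fintype (Z p)] (p : P) (M : Matrix (Z p) (Z p) ℂ)
    (V : ∀ p, Matrix (Z p) (X p) ℂ) (ψ : Vec X) :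
    applyAt p M (applyLocal V ψ) = applyLocal (Function.update V p (M * V p)) ψ := by
  apply cutMatrix_injective p
  have hrest (q : {q // q ≠ p}) : Function.update V p (M * V p) q = V q :=
    Function.update_of_ne q.2 _ _
  simp only [cutMatrix_applyAt, cutMatrix_applyLocal, hrest, Function.update_self,
    Matrix.mul_assoc]

theorem sum_norm_sq_applyAt [∀ p, DecidableEq (X p)] {ι : Type*} [Fintype ι] (p : P)
    {M : ι → Matrix (X p) (X p) ℂ} (hM : ∑ o, (M o)ᴴ * M o = 1) (ψ : Vec X) :
    ∑ o, ‖applyAt p (M o) ψ‖ ^ 2 = ‖ψ‖ ^ 2 := by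
  simp only [← frobenius_norm_sq_cutMatrix p, cutMatrix_applyAt, sum_frobenius_norm_sq_mul hM]

/-- The reduced density matrix of party `p` in the state `ψ`. -/
def reducedState (p : P) (ψ : Vec X) : Matrix (X p) (X p) ℂ :=
  cutMatrix p ψ * (cutMatrix p ψ)ᴴ

end Cut

section Discrimination

variable {P : Type} [Fintype P] [DecidableEq P] {X Z : P → Type} [∀ p, Fintype (X p)]
  [∀ p, DecidableEq (X p)] {L : Type} [DecidableEq L]

theorem Rounds.sum_prob [Fintype L] (R : Rounds X L) (ψ : Vec X) :
    ∑ l, R.prob l ψ = ‖ψ‖ ^ 2 := by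
  induction R generalizing ψ with
  | output l' => simp [Rounds.prob]
  | measure p r M hM next ih =>
    simp only [Rounds.prob]
    rw [Finset.sum_comm, ← sum_norm_sq_applyAt p hM ψ]
    exact Finset.sum_congr rfl fun o _ => ih o _

/-- Every product operator gives `ψ` at most `κ` times the total weight that it gives to the
product basis. Each transcript of a protocol acts as such an operator, so `κ` limits how well `ψ`
can be singled out by LOCC. -/
def ProductBounded (κ : ℝ) (ψ : Vec X) : Prop :=
  ∀ (Z : P → Type) [∀ p, Fintype (Z p)] (V : ∀ p, Matrix (Z p) (X p) ℂ),
    ‖applyLocal V ψ‖ ^ 2 ≤ κ * ∑ x, ‖applyLocal V (EuclideanSpace.single x 1)‖ ^ 2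

theorem ProductBounded.prob_le [∀ p, Fintype (Z p)] [∀ p, DecidableEq (Z p)] {κ : ℝ} {ψ : Vec X}
    (hψ : ProductBounded κ ψ) (l : L) (R : Rounds Z L) (V : ∀ p, Matrix (Z p) (X p) ℂ) :
    R.prob l (applyLocal V ψ) ≤
      κ * ∑ x, R.prob l (applyLocal V (EuclideanSpace.single x 1)) := by
  induction R generalizing V with
  | output l' =>
    by_cases h : l' = l
    · simpa only [Rounds.prob, if_pos h] using hψ Z V
    · simp [Rounds.prob, h]
  | measure p r M hM next ih =>
    simp only [Rounds.prob, applyAt_applyLocal]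
    rw [Finset.sum_comm, Finset.mul_sum]
    exact Finset.sum_le_sum fun o _ => ih o _

theorem card_le_of_forall_prob_eq_one [Fintype L] {κ : ℝ} {ψ : L → Vec X}
    (hψ : ∀ l, ProductBounded κ (ψ l)) (π : LOCC X L) (hπ : ∀ l, π.prob (ψ l) l = 1) :
    Fintype.card L ≤ κ * Fintype.card (∀ p, X p) := by
  let _ := π.fintypeSpace
  let _ := π.decEqSpace
  calc (Fintype.card L : ℝ) = ∑ l, π.prob (ψ l) l := by simp [hπ]
    _ = ∑ l, π.rounds.prob l (applyLocal π.embed (ψ l)) := rfl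
    _ ≤ ∑ l, κ * ∑ x, π.rounds.prob l (applyLocal π.embed (EuclideanSpace.single x 1)) :=
        Finset.sum_le_sum fun l _ => (hψ l).prob_le l π.rounds π.embed
    _ = κ * ∑ x, ‖applyLocal π.embed (EuclideanSpace.single x 1)‖ ^ 2 := by
        rw [← Finset.mul_sum, Finset.sum_comm]
        simp only [Rounds.sum_prob]
    _ = κ * Fintype.card (∀ p, X p) := by
        simp only [sum_norm_sq_applyLocal_single, Fintype.card_pi, Nat.cast_prod,
          frobenius_norm_sq_of_conjTranspose_mul_self (π.isometry _)]

theorem productBounded_of_reducedState_eq {p : P} {κ : ℝ} {ψ : Vec X}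
    (hψ : reducedState p ψ = κ • 1) : ProductBounded κ ψ := by
  intro Z _ V
  calc ‖applyLocal V ψ‖ ^ 2
      = ‖V p * cutMatrix p ψ * (tensorMatrix fun q : {q // q ≠ p} => V q)ᵀ‖ ^ 2 := by
        rw [← frobenius_norm_sq_cutMatrix p, cutMatrix_applyLocal]
    _ ≤ (‖V p * cutMatrix p ψ‖ * ‖(tensorMatrix fun q : {q // q ≠ p} => V q)ᵀ‖) ^ 2 := by
        gcongr
        exact Matrix.frobenius_norm_mul _ _
    _ = κ * (‖V p‖ ^ 2 * ∏ q : {q // q ≠ p}, ‖V q‖ ^ 2) := by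
        rw [mul_pow, frobenius_norm_sq_mul_of_mul_conjTranspose_self hψ,
          Matrix.frobenius_norm_transpose, frobenius_norm_sq_tensorMatrix, mul_assoc]
    _ = κ * ∑ x, ‖applyLocal V (EuclideanSpace.single x 1)‖ ^ 2 := by
        rw [sum_norm_sq_applyLocal_single, Fintype.prod_eq_mul_prod_subtype_ne _ p]

end Discrimination

section Shared

variable {P : Type} [DecidableEq P] {X : P → Type} {n m : ℕ}

theorem cutMatrix_shared_apply (p : P) (ψ : Fin n → Vec X) (a : Fin m ↪ Fin n) (s : Fin m → X p)
    (y : ∀ q : {q // q ≠ p}, Fin m → X q) :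
    cutMatrix p (shared ψ a) s y = ∏ k, cutMatrix p (ψ (a k)) (s k) fun q => y q k := by
  simp only [cutMatrix, shared, Matrix.of_apply]
  refine Finset.prod_congr rfl fun k _ => congrArg (ψ (a k)) (funext fun q => ?_)
  by_cases hq : q = p
  · subst hq
    rw [piSplitAt_symm_self, piSplitAt_symm_self]
  · rw [piSplitAt_symm_coe (X := Copies X m) p s y ⟨q, hq⟩,
      piSplitAt_symm_coe p (s k) _ ⟨q, hq⟩]

variable [Fintype P] [∀ p, Fintype (X p)]

theorem norm_sq_shared (ψ : Fin n → Vec X) (a : Fin m ↪ Fin n) :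
    ‖shared ψ a‖ ^ 2 = ∏ k, ‖ψ (a k)‖ ^ 2 := by
  simp only [EuclideanSpace.norm_sq_eq, Fintype.prod_sum, shared, norm_prod, ← Finset.prod_pow]
  exact (Equiv.piComm fun p (_ : Fin m) => X p).sum_comp fun x => ∏ k, ‖ψ (a k) (x k)‖ ^ 2

theorem reducedState_shared (p : P) (ψ : Fin n → Vec X) (a : Fin m ↪ Fin n) :
    reducedState p (shared ψ a) = tensorMatrix fun k => reducedState p (ψ (a k)) := by
  ext s t
  simp only [reducedState, tensorMatrix, Matrix.of_apply, Matrix.mul_apply,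
    Matrix.conjTranspose_apply, cutMatrix_shared_apply, star_prod, ← Finset.prod_mul_distrib,
    Fintype.prod_sum]
  exact (Equiv.piComm fun (q : {q // q ≠ p}) (_ : Fin m) => X q).sum_comp fun y =>
    ∏ k, cutMatrix p (ψ (a k)) (s k) (y k) * star (cutMatrix p (ψ (a k)) (t k) (y k))

theorem Markable.descFactorial_le [∀ p, DecidableEq (X p)] {ψ : Fin n → Vec X} {p : P} {κ : ℝ}
    (h : Markable ψ m) (hψ : ∀ i, reducedState p (ψ i) = κ • 1) :
    n.descFactorial m ≤ (κ * Fintype.card (∀ p, X p)) ^ m := by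
  obtain ⟨π, hπ⟩ := h
  have hreduced (a : Fin m ↪ Fin n) : reducedState p (shared ψ a) = κ ^ m • 1 := by
    simp only [reducedState_shared, hψ, tensorMatrix_smul, tensorMatrix_one, Finset.prod_const,
      Finset.card_univ, Fintype.card_fin]
  have hcard := card_le_of_forall_prob_eq_one
    (fun a => productBounded_of_reducedState_eq (hreduced a)) π hπ
  simpa [Fintype.card_embedding_eq, Fintype.card_pi, mul_pow, Finset.prod_pow] using hcard

end Shared

section Bell

/-- The coefficient matrices of the Bell states, up to the factor `1 / √2`. They are the Pauli
matrices, with `σ_z σ_x` in place of `σ_y` to keep the entries integral. -/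
def bellMatrix : Fin 4 → Matrix (Fin 2) (Fin 2) ℤ :=
  ![!![1, 0; 0, 1], !![1, 0; 0, -1], !![0, 1; 1, 0], !![0, 1; -1, 0]]

theorem bellMatrix_transpose (i : Fin 4) : ∃ ε : ℤˣ, (bellMatrix i)ᵀ = ε • bellMatrix i := by
  revert i; decide

-- The Pauli matrices represent the Klein four-group up to sign; bitwise `^^^` is its operation.
theorem bellMatrix_mul (i j : Fin 4) :
    ∃ ε : ℤˣ, bellMatrix i * bellMatrix j = ε • bellMatrix (i ^^^ j) := by
  revert i j; decide

theorem trace_bellMatrix {i : Fin 4} (hi : i ≠ 0) : (bellMatrix i).trace = 0 := by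
  revert i; decide

theorem bellMatrix_mul_transpose_self (i : Fin 4) : bellMatrix i * (bellMatrix i)ᵀ = 1 := by
  revert i; decide

theorem trace_bellMatrix_mul_transpose (i j : Fin 4) :
    (bellMatrix i * (bellMatrix j)ᵀ).trace = if i = j then 2 else 0 := by
  split_ifs with hij
  · rw [hij, bellMatrix_mul_transpose_self, Matrix.trace_one, Fintype.card_fin, Nat.cast_two]
  · have hne : i ^^^ j ≠ 0 := by decide +revert
    obtain ⟨ε, hε⟩ := bellMatrix_transpose j
    obtain ⟨δ, hδ⟩ := bellMatrix_mul i j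
    rw [hε, Matrix.mul_smul, hδ, Matrix.trace_smul, Matrix.trace_smul, trace_bellMatrix hne,
      smul_zero, smul_zero]

theorem trace_bellMatrix_swap {i j a b : Fin 4} (h : i ^^^ j ≠ a ^^^ b) :
    ((bellMatrix i)ᵀ * bellMatrix a * (bellMatrix j * (bellMatrix b)ᵀ)).trace = 0 := by
  have hne : i ^^^ a ^^^ (j ^^^ b) ≠ 0 := by decide +kernel +revert
  obtain ⟨ε, hε⟩ := bellMatrix_transpose i
  obtain ⟨δ, hδ⟩ := bellMatrix_transpose b
  obtain ⟨α, hα⟩ := bellMatrix_mul i a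
  obtain ⟨β, hβ⟩ := bellMatrix_mul j b
  obtain ⟨γ, hγ⟩ := bellMatrix_mul (i ^^^ a) (j ^^^ b)
  simp only [hε, hδ, Matrix.smul_mul, Matrix.mul_smul, hα, hβ, hγ, Matrix.trace_smul,
    trace_bellMatrix hne, smul_zero]

theorem sum_fin_two_arrow {α M : Type*} [Fintype α] [AddCommMonoid M] (f : (Fin 2 → α) → M) :
    ∑ x, f x = ∑ s, ∑ t, f ![s, t] := by
  rw [← (finTwoArrowEquiv α).symm.sum_comp, Fintype.sum_prod_type]
  rfl

theorem bell_apply (i : Fin 4) (s t : Fin 2) :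
    bell i ![s, t] = (√2 : ℂ)⁻¹ * bellMatrix i s t := by
  fin_cases i <;> fin_cases s <;> fin_cases t <;> simp [bell, ket, bellMatrix]

theorem star_bell_apply (i : Fin 4) (x : Fin 2 → Fin 2) : star (bell i x) = bell i x := by
  obtain ⟨⟨s, t⟩, rfl⟩ := (finTwoArrowEquiv (Fin 2)).symm.surjective x
  simp [bell_apply]

theorem bell_mul_bell (i j : Fin 4) (s t u v : Fin 2) :
    bell i ![s, t] * bell j ![u, v] = 2⁻¹ * ((bellMatrix i s t * bellMatrix j u v : ℤ) : ℂ) := by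
  have hsqrt : (√2 : ℂ)⁻¹ * (√2 : ℂ)⁻¹ = 2⁻¹ := by
    rw [← mul_inv, ← Complex.ofReal_mul, Real.mul_self_sqrt zero_le_two, Complex.ofReal_ofNat]
  rw [bell_apply, bell_apply, mul_mul_mul_comm, hsqrt, Int.cast_mul]

theorem inner_bell (i j : Fin 4) :
    inner ℂ (bell i) (bell j) = 2⁻¹ * ((bellMatrix i * (bellMatrix j)ᵀ).trace : ℂ) := by
  simp only [PiLp.inner_apply, RCLike.inner_apply', ← RCLike.star_def, star_bell_apply]
  rw [sum_fin_two_arrow]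
  simp only [bell_mul_bell, ← Finset.mul_sum, ← Int.cast_sum]
  rfl

theorem orthonormal_bell : Orthonormal ℂ bell := by
  rw [orthonormal_iff_ite]
  intro i j
  rw [inner_bell, trace_bellMatrix_mul_transpose]
  split_ifs <;> norm_num

theorem reducedState_zero_apply {α : Type} [Fintype α] (ψ : Vec fun _ : Fin 2 => α) (s t : α) :
    reducedState 0 ψ s t = ∑ u, ψ ![s, u] * star (ψ ![t, u]) := by
  let _ : Unique {q : Fin 2 // q ≠ 0} := ⟨⟨⟨1, by decide⟩⟩, by decide⟩
  have hcut (r u : α) : cutMatrix 0 ψ r (fun _ => u) = ψ ![r, u] := by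
    refine congrArg ψ (funext fun q => ?_)
    fin_cases q <;> rfl
  simp only [reducedState, Matrix.mul_apply, Matrix.conjTranspose_apply, ← hcut]
  exact ((Equiv.funUnique {q : Fin 2 // q ≠ 0} α).symm.sum_comp _).symm

theorem reducedState_bell (i : Fin 4) :
    reducedState (X := Qubits) 0 (bell i) = (2⁻¹ : ℝ) • 1 := by
  ext s t
  simp only [reducedState_zero_apply, star_bell_apply, bell_mul_bell, ← Finset.mul_sum,
    ← Int.cast_sum]
  change 2⁻¹ * (((bellMatrix i * (bellMatrix i)ᵀ) s t : ℤ) : ℂ) = _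
  rw [bellMatrix_mul_transpose_self]
  simp [Matrix.one_apply]

theorem shared_bell_apply (e : Fin 3 ↪ Fin 4) (a : Fin 2 ↪ Fin 3) (s t u v : Fin 2) :
    shared (threeBell e) a ![![s, t], ![u, v]] =
      bell (e (a 0)) ![s, u] * bell (e (a 1)) ![t, v] := by
  have hpair (k : Fin 2) : (fun p => ![![s, t], ![u, v]] p k) = ![![s, t] k, ![u, v] k] := by
    funext p
    fin_cases p <;> rfl
  simp only [shared, threeBell, Fin.prod_univ_two, hpair]
  rfl

/-- The unnormalized state after the two parties, each holding two qubits of `ψ`, have measured them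
in the Bell basis with outcomes `i` and `j`. -/
def bellOutcome (i j : Fin 4) (ψ : Vec (Copies Qubits 2)) : Vec (Copies Qubits 2) :=
  applyAt (Z := Copies Qubits 2) 1 (bellProj j) (applyAt (Z := Copies Qubits 2) 0 (bellProj i) ψ)

theorem bellOutcome_apply (i j : Fin 4) (ψ : Vec (Copies Qubits 2)) (z : ∀ p, Copies Qubits 2 p) :
    bellOutcome i j ψ z =
      bell i (z 0) * bell j (z 1) * ∑ x, bell i (x 0) * bell j (x 1) * ψ x := by
  conv_lhs => rw [bellOutcome, ← applyLocal_one ψ, applyAt_applyLocal, applyAt_applyLocal]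
  simp only [applyLocal, Fin.prod_univ_two, Finset.mul_sum]
  refine Finset.sum_congr rfl fun x _ => ?_
  simp only [bellProj, Matrix.of_apply, star_bell_apply, ne_eq, zero_ne_one, one_ne_zero,
    not_false_eq_true, Function.update_of_ne, Function.update_self, mul_one]
  ring

theorem sum_norm_sq_bellOutcome (ψ : Vec (Copies Qubits 2)) :
    ∑ i, ∑ j, ‖bellOutcome i j ψ‖ ^ 2 = ‖ψ‖ ^ 2 := by
  have hmeasure (p : Fin 2) (φ : Vec (Copies Qubits 2)) :
      ∑ i, ‖applyAt (Z := Copies Qubits 2) p (bellProj i) φ‖ ^ 2 = ‖φ‖ ^ 2 :=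
    sum_norm_sq_applyAt (X := Copies Qubits 2) p bellProj_complete φ
  simp only [bellOutcome, hmeasure]

theorem sum_bell_mul_bell_mul_shared (e : Fin 3 ↪ Fin 4) (a : Fin 2 ↪ Fin 3) (i j : Fin 4) :
    ∑ x : ∀ p, Copies Qubits 2 p, bell i (x 0) * bell j (x 1) * shared (threeBell e) a x =
      4⁻¹ * (((bellMatrix i)ᵀ * bellMatrix (e (a 0)) *
        (bellMatrix j * (bellMatrix (e (a 1)))ᵀ)).trace : ℂ) := by
  have hexpand : ∑ x : ∀ p, Copies Qubits 2 p,
      bell i (x 0) * bell j (x 1) * shared (threeBell e) a x =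
      4⁻¹ * ((∑ s, ∑ t, ∑ u, ∑ v, bellMatrix i s t * bellMatrix j u v *
        (bellMatrix (e (a 0)) s u * bellMatrix (e (a 1)) t v) : ℤ) : ℂ) := by
    refine (sum_fin_two_arrow (α := Fin 2 → Fin 2) _).trans ?_
    simp only [sum_fin_two_arrow, shared_bell_apply, Matrix.cons_val_zero, Matrix.cons_val_one,
      bell_mul_bell, Int.cast_sum, Finset.mul_sum]
    congr! 4
    push_cast
    ring
  rw [hexpand]
  congr 2
  simp only [Matrix.trace, Matrix.diag, Matrix.mul_apply, Matrix.transpose_apply,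
    Fin.sum_univ_two]
  ring

theorem bellOutcome_shared_eq_zero {e : Fin 3 ↪ Fin 4} {a : Fin 2 ↪ Fin 3} {i j : Fin 4}
    (h : i ^^^ j ≠ e (a 0) ^^^ e (a 1)) : bellOutcome i j (shared (threeBell e) a) = 0 := by
  ext z
  rw [bellOutcome_apply, sum_bell_mul_bell_mul_shared, trace_bellMatrix_swap h, Int.cast_zero,
    mul_zero, mul_zero, PiLp.zero_apply]

/-- The pair of members of the family whose indices in the Klein four-group have the same product
as the two outcomes `i`, `j`. -/
def bellOut (e : Fin 3 ↪ Fin 4) (i j : Fin 4) : Finset (Fin 3) :=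
  {k | ∃ k', k' ≠ k ∧ e k ^^^ e k' = i ^^^ j}

-- Two different pairs among three indices share an index, which cancels from their products.
theorem bellOut_eq_map {e : Fin 3 ↪ Fin 4} {a : Fin 2 ↪ Fin 3} {i j : Fin 4}
    (h : i ^^^ j = e (a 0) ^^^ e (a 1)) : bellOut e i j = Finset.univ.map a := by
  have hcomm (x y : Fin 4) : x ^^^ y = y ^^^ x := by decide +revert
  have hcancel (x y z : Fin 4) : x ^^^ y = z ^^^ y → x = z := by decide +revert
  have hne : a 0 ≠ a 1 := a.injective.ne (by decide)
  ext k
  simp only [bellOut, h, Finset.mem_filter_univ, Finset.mem_map, Finset.mem_univ, true_and,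
    Fin.exists_fin_two]
  constructor
  · rintro ⟨k', hk', hxor⟩
    by_contra! hk
    obtain rfl | rfl : k' = a 0 ∨ k' = a 1 := by omega
    · exact hk.2 (e.injective (hcancel _ _ _ (hxor.trans (hcomm _ _)))).symm
    · exact hk.1 (e.injective (hcancel _ _ _ hxor)).symm
  · rintro (rfl | rfl)
    · exact ⟨a 1, hne.symm, rfl⟩
    · exact ⟨a 0, hne, hcomm _ _⟩

theorem bellProtocol_prob {L : Type} [DecidableEq L] (out : Fin 4 → Fin 4 → L)
    (ψ : Vec (Copies Qubits 2)) (l : L) :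
    (bellProtocol out).prob ψ l =
      ∑ i, ∑ j, if out i j = l then ‖bellOutcome i j ψ‖ ^ 2 else 0 := by
  have hone : applyLocal (bellProtocol out).embed ψ = ψ := applyLocal_one ψ
  rw [LOCC.prob, hone]
  rfl

theorem bellProtocol_identifies (e : Fin 3 ↪ Fin 4) :
    (bellProtocol (bellOut e)).Identifies (threeBell e) := by
  intro a
  calc (bellProtocol (bellOut e)).prob (shared (threeBell e) a) (Finset.univ.map a)
      = ∑ i, ∑ j, ‖bellOutcome i j (shared (threeBell e) a)‖ ^ 2 := by
        rw [bellProtocol_prob]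
        refine Finset.sum_congr rfl fun i _ => Finset.sum_congr rfl fun j _ => ?_
        by_cases h : i ^^^ j = e (a 0) ^^^ e (a 1)
        · rw [if_pos (bellOut_eq_map h)]
        · simp [bellOutcome_shared_eq_zero h]
    _ = ‖shared (threeBell e) a‖ ^ 2 := sum_norm_sq_bellOutcome _
    _ = 1 := by simp [norm_sq_shared, threeBell, orthonormal_bell.norm_eq_one]

theorem not_markable_threeBell (e : Fin 3 ↪ Fin 4) : ¬ Markable (threeBell e) 2 := by
  intro h
  have hbound := h.descFactorial_le (p := 0) fun i => reducedState_bell (e i)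
  norm_num [Nat.descFactorial] at hbound

end Bell

end LocalSubset

end

theorem theorem32 :
    (¬ ∀ (N : ℕ) (d : Fin N → ℕ) (n m : ℕ) (ψ : Fin n → LocalSubset.Vec fun p => Fin (d p)),
        Orthonormal ℂ ψ → 1 ≤ m → m < n →
          LocalSubset.Identifiable ψ m → LocalSubset.Markable ψ m) ∧
    ∀ e : Fin 3 ↪ Fin 4,
      Orthonormal ℂ (LocalSubset.threeBell e) ∧
      (∃ out : Fin 4 → Fin 4 → Finset (Fin 3),
        (LocalSubset.bellProtocol out).Identifies (LocalSubset.threeBell e)) ∧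
      LocalSubset.Identifiable (LocalSubset.threeBell e) 2 ∧
      ¬ LocalSubset.Markable (LocalSubset.threeBell e) 2 := by
  have hthree (e : Fin 3 ↪ Fin 4) : Orthonormal ℂ (LocalSubset.threeBell e) ∧
      (LocalSubset.bellProtocol (LocalSubset.bellOut e)).Identifies (LocalSubset.threeBell e) ∧
      ¬ LocalSubset.Markable (LocalSubset.threeBell e) 2 :=
    ⟨LocalSubset.orthonormal_bell.comp e e.injective, LocalSubset.bellProtocol_identifies e,
      LocalSubset.not_markable_threeBell e⟩
  constructor
  · intro hmarkable
    obtain ⟨horth, hid, hnot⟩ := hthree Fin.castSuccEmb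
    exact hnot (hmarkable 2 (fun _ => 2) 3 2 _ horth (by norm_num) (by norm_num) ⟨_, hid⟩)
  · intro e
    obtain ⟨horth, hid, hnot⟩ := hthree e
    exact ⟨horth, ⟨_, hid⟩, ⟨_, hid⟩, hnot⟩
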